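/- Let $r_3, r_4, r_5, \dots$ be independent random variables, each uniformly distributed on $[0,1]$. For $n \ge 3$ put $z_n = 1$ if $r_n \le 1/\log n$ and $z_n = 0$ otherwise, so that the $z_n$ are independent with $\Pr[z_n = 1] = 1/\log n$. The random integers $n \ge 3$ with $z_n = 1$ are called pseudo-primes; almost surely there are infinitely many of them, and they are listed in increasing order as $p'_1 < p'_2 < \cdots$. Let $\chi$ be a non-principal Dirichlet character of modulus $k \ge 1$, and write $\chi(n) = e^{i\theta_n}$ for $(n,k) = 1$. Put $z_{n,k} = z_n$ if $(n,k) = 1$, $z_{n,k} = 0$ otherwise, and $$C'_N \;=\; \sum_{n=3}^{p'_N} z_{n,k} \cos\theta_n \;=\; \sum_{\substack{1 \le i \le N \\ (p'_i,k) = 1}} \cos \theta_{p'_i}.$$ Then, as $N \to \infty$, we have convergence in distribution $$\sqrt{\frac{1 + \frac{\log\log N}{\log N}}{s^2 N}}\; C'_N \;\overset{d}{\longrightarrow}\; \mathcal N(0,1), \qquad s^2 = a\,\frac{\varphi(k)}{k},$$ where $a = 1$ if all values of $\chi$ are real and $a = 1/2$ otherwise, $\varphi$ is the Euler totient, and $\mathcal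 N(0,1)$ is the standard normal distribution. -/

import Mathlib

open MeasureTheory ProbabilityTheory Filter

noncomputable section

namespace CramerModel

variable {Ω : Type*}

/-- The indicator `z_n` of the event that `n` is a pseudo-prime: for `n ≥ 3`, `z_n = 1` if
`r_n ≤ 1 / log n`; otherwise `z_n = 0`. -/
def z (r : ℕ → Ω → ℝ) (n : ℕ) (ω : Ω) : ℝ :=
  open Classical in if 3 ≤ n ∧ r n ω ≤ 1 / Real.log n then 1 else 0

/-- The restriction `z_{n,k}` of `z_n` to the integers `n` coprime to `k`. -/
def zCoprime (r : ℕ → Ω → ℝ) (k n : ℕ) (ω : Ω) : ℝ :=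
  if n.Coprime k then z r n ω else 0

/-- The pseudo-primes `p'_1 < p'_2 < ⋯`: `p'_N` is the `N`-th (`N ≥ 1`) integer `n` with
`z_n = 1`. It is `0` if there are fewer than `N` such integers, an event of probability zero. -/
def pseudoPrime (r : ℕ → Ω → ℝ) (N : ℕ) (ω : Ω) : ℕ :=
  Nat.nth (fun n => z r n ω = 1) (N - 1)

/-- The angle `θ_n = Arg χ(n)`, relevant only when `χ(n) ≠ 0`. -/
def theta {k : ℕ} (χ : DirichletCharacter ℂ k) (n : ℕ) : ℝ :=
  Complex.arg (χ (n : ZMod k))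

/-- The random series `C'_N = ∑_{n = 1}^{p'_N} z_{n,k} cos θ_n`, that is, the sum of
`cos θ_{p'_n}` over those of the first `N` pseudo-primes that are coprime to `k`. -/
def C {k : ℕ} (χ : DirichletCharacter ℂ k) (r : ℕ → Ω → ℝ) (N : ℕ) (ω : Ω) : ℝ :=
  ∑ n ∈ Finset.Icc 1 (pseudoPrime r N ω), zCoprime r k n ω * Real.cos (theta χ n)

/-- `a = 1` if all values of `χ` are real, and `a = 1/2` otherwise. -/
def a {k : ℕ} (χ : DirichletCharacter ℂ k) : ℝ :=
  open Classical in if ∀ x : ZMod k, (χ x).im = 0 then 1 else 1 / 2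

/-- `s² = a φ(k) / k`. -/
def sSq {k : ℕ} (χ : DirichletCharacter ℂ k) : ℝ :=
  a χ * (Nat.totient k : ℝ) / (k : ℝ)

/-- When there are infinitely many pseudo-primes (which is almost surely the case), `C'_N` is the
sum of `cos θ_{p'_i}` over the `1 ≤ i ≤ N` with `p'_i` coprime to `k`. -/
theorem C_eq_sum_pseudoPrime {k : ℕ} (χ : DirichletCharacter ℂ k) (r : ℕ → Ω → ℝ) (ω : Ω)
    (hinf : {n | z r n ω = 1}.Infinite) (N : ℕ) (hN : 1 ≤ N) :
    C χ r N ω = ∑ i ∈ (Finset.Icc 1 N).filter (fun i => (pseudoPrime r i ω).Coprime k),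
      Real.cos (theta χ (pseudoPrime r i ω)) := by
  classical
  have h01 : ∀ n, z r n ω ≠ 1 → z r n ω = 0 := by
    intro n hn
    unfold z at hn ⊢
    split_ifs at hn ⊢ with h
    · exact absurd rfl hn
    · rfl
  have hpos : ∀ n, z r n ω = 1 → 1 ≤ n := by
    intro n hn
    unfold z at hn
    split_ifs at hn with h
    · omega
    · norm_num at hn
  have hmono := Nat.nth_strictMono hinf
  have himg : (Finset.Icc 1 (pseudoPrime r N ω)).filter (fun n => z r n ω = 1)
      = (Finset.Icc 1 N).image (fun i => pseudoPrime r i ω) := by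
    ext n
    simp only [Finset.mem_filter, Finset.mem_Icc, Finset.mem_image, pseudoPrime]
    constructor
    · rintro ⟨⟨-, h2⟩, h3⟩
      refine ⟨Nat.count (fun n => z r n ω = 1) n + 1, ⟨by omega, ?_⟩, ?_⟩
      · have h4 : Nat.nth (fun n => z r n ω = 1) (Nat.count (fun n => z r n ω = 1) n)
            ≤ Nat.nth (fun n => z r n ω = 1) (N - 1) := by
          rw [Nat.nth_count (p := fun n => z r n ω = 1) h3]; exact h2
        have := hmono.le_iff_le.1 h4
        omega
      · rw [Nat.add_sub_cancel, Nat.nth_count (p := fun n => z r n ω = 1) h3]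
    · rintro ⟨i, ⟨h1, h2⟩, rfl⟩
      have hz := Nat.nth_mem_of_infinite hinf (i - 1)
      exact ⟨⟨hpos _ hz, hmono.monotone (by omega)⟩, hz⟩
  have hinj : Set.InjOn (fun i => pseudoPrime r i ω) (Finset.Icc 1 N : Finset ℕ) := by
    intro i hi j hj hij
    simp only [Finset.coe_Icc, Set.mem_Icc] at hi hj
    have := hmono.injective hij
    omega
  have hC : C χ r N ω = ∑ n ∈ (Finset.Icc 1 (pseudoPrime r N ω)).filter (fun n => z r n ω = 1),
      if n.Coprime k then Real.cos (theta χ n) else 0 := by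
    rw [Finset.sum_filter, C]
    refine Finset.sum_congr rfl fun n _ => ?_
    by_cases h : z r n ω = 1
    · by_cases hc : n.Coprime k <;> simp [zCoprime, h, hc]
    · by_cases hc : n.Coprime k <;> simp [zCoprime, h01 n h, hc]
  rw [hC, himg, Finset.sum_image hinj, Finset.sum_filter]

end CramerModel

end

/-! Put $q_n = 1/\log n$ and $L(M) = \sum q_n$ over the first $M$ integers $n \ge 3$. Then $C'_N$ is
the sum of $z_n \operatorname{Re}\chi(n)$ stopped at the $N$-th success of independent trials with
success probabilities $q_n$. Write $z_n = (z_n - q_n) + q_n$.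

The drift $\sum q_n \operatorname{Re}\chi(n)$ stays bounded wherever it is stopped: $\chi$ is
non-principal, so $\operatorname{Re}\chi$ has mean zero over a period, and $q_n$ decreases to 0
(Dirichlet's test, `exists_abs_sum_mul_natCast_add_le`). Division by $\sqrt N$ removes it.

The centred sum is a martingale stopped at a random time. The number of successes fluctuates by
about $\sqrt N$, so by Chebyshev the $N$-th success falls, with high probability, in the window
where $L$ runs from about $N - N^{3/4}$ to about $N + N^{3/4}$. The stopped martingale gains
variance only $O(N^{3/4}) = o(N)$ across the window, so the random time may be replaced by the left
end of the window (`measureReal_stopped_sub_le`).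

At that deterministic time the central limit theorem for bounded independent summands applies. The
variance is asymptotic to $s^2 L \sim s^2 N$, because $q_n \to 0$ and $(\operatorname{Re}\chi)^2$
has mean $s^2$ over a period (`tendsto_sum_variance_div`, `sum_re_sq_eq`). The factor $1 + \log\log
N/\log N$ tends to 1 and does not affect the limit. -/

/-! ### Characteristic functions and the central limit theorem for bounded summands -/

/-- Factors are exchanged one at a time, the others having norm at most 1. This reduces comparison
with the Gaussian to one summand at a time. -/
theorem norm_prod_sub_prod_le_sum {ι : Type*} (s : Finset ι) (a b : ι → ℂ)
    (ha : ∀ i ∈ s, ‖a i‖ ≤ 1) (hb : ∀ i ∈ s, ‖b i‖ ≤ 1) :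
    ‖∏ i ∈ s, a i - ∏ i ∈ s, b i‖ ≤ ∑ i ∈ s, ‖a i - b i‖ := by
  classical
  induction s using Finset.induction_on with
  | empty => simp
  | insert j s hj ih =>
    rw [Finset.prod_insert hj, Finset.prod_insert hj, Finset.sum_insert hj]
    have ih' := ih (fun i hi => ha i (Finset.mem_insert_of_mem hi))
      (fun i hi => hb i (Finset.mem_insert_of_mem hi))
    have hbs : ‖∏ i ∈ s, b i‖ ≤ 1 := by
      rw [norm_prod]
      exact Finset.prod_le_one (fun _ _ => norm_nonneg _)
        (fun i hi => hb i (Finset.mem_insert_of_mem hi))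
    have h1 := ha j (Finset.mem_insert_self j s)
    calc ‖a j * ∏ i ∈ s, a i - b j * ∏ i ∈ s, b i‖
        = ‖a j * (∏ i ∈ s, a i - ∏ i ∈ s, b i) + (a j - b j) * ∏ i ∈ s, b i‖ := by
          congr 1; ring
      _ ≤ ‖a j‖ * ‖∏ i ∈ s, a i - ∏ i ∈ s, b i‖ + ‖a j - b j‖ * ‖∏ i ∈ s, b i‖ := by
          rw [← norm_mul, ← norm_mul]; exact norm_add_le _ _
      _ ≤ 1 * ‖∏ i ∈ s, a i - ∏ i ∈ s, b i‖ + ‖a j - b j‖ * 1 := by gcongr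
      _ ≤ _ := by linarith

section

variable {Ω : Type*} [MeasurableSpace Ω] {μ : Measure Ω} [IsProbabilityMeasure μ]

theorem integrable_of_abs_le {X : Ω → ℝ} (hX : Measurable X) {B : ℝ} (hB : ∀ ω, |X ω| ≤ B) :
    Integrable X μ :=
  Integrable.of_bound hX.aestronglyMeasurable B (ae_of_all _ hB)

/-- Second order expansion at `0` of the characteristic function of a centred random variable
bounded by `1`. -/
theorem norm_charFun_map_sub_le {X : Ω → ℝ} (hX : Measurable X) (hb : ∀ ω, |X ω| ≤ 1)
    (h0 : ∫ ω, X ω ∂μ = 0) {t : ℝ} (ht : |t| ≤ 1) :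
    ‖charFun (μ.map X) t - ((1 - t ^ 2 * (∫ ω, X ω ^ 2 ∂μ) / 2 : ℝ) : ℂ)‖
      ≤ |t| ^ 3 * ∫ ω, X ω ^ 2 ∂μ := by
  have hX1 : Integrable X μ := integrable_of_abs_le hX hb
  have hX2 : Integrable (fun ω => X ω ^ 2) μ :=
    integrable_of_abs_le (hX.pow_const 2) (B := 1) fun ω => by
      rw [abs_pow]; exact pow_le_one₀ (abs_nonneg _) (hb ω)
  have hE : Integrable (fun ω => Complex.exp (t * X ω * Complex.I)) μ := by
    refine Integrable.of_bound (by fun_prop) 1 (ae_of_all _ fun ω => ?_)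
    rw [← Complex.ofReal_mul, Complex.norm_exp_ofReal_mul_I]
  have hP : Integrable (fun ω => (1 : ℂ) + t * Complex.I * (X ω : ℂ)
      - (t ^ 2 / 2 : ℂ) * ((X ω ^ 2 : ℝ) : ℂ)) μ :=
    ((integrable_const _).add (hX1.ofReal.const_mul _)).sub (hX2.ofReal.const_mul _)
  have hPi : ∫ ω, ((1 : ℂ) + t * Complex.I * (X ω : ℂ)
      - (t ^ 2 / 2 : ℂ) * ((X ω ^ 2 : ℝ) : ℂ)) ∂μ
      = ((1 - t ^ 2 * (∫ ω, X ω ^ 2 ∂μ) / 2 : ℝ) : ℂ) := by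
    rw [integral_sub ((integrable_const _).add (hX1.ofReal.const_mul _)) (hX2.ofReal.const_mul _),
      integral_add (integrable_const _) (hX1.ofReal.const_mul _), integral_const_mul,
      integral_const_mul, integral_complex_ofReal, integral_complex_ofReal, h0]
    simp
    ring
  rw [charFun_apply_real, integral_map hX.aemeasurable (by fun_prop), ← hPi,
    ← integral_sub hE hP, ← integral_const_mul]
  refine norm_integral_le_of_norm_le (hX2.const_mul _) (ae_of_all _ fun ω => ?_)
  have hx : ‖(t * X ω * Complex.I : ℂ)‖ = |t| * |X ω| := by simp
  have hle : ‖(t * X ω * Complex.I : ℂ)‖ ≤ 1 := by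
    rw [hx]; exact mul_le_one₀ ht (abs_nonneg _) (hb ω)
  have key := Complex.exp_bound hle (n := 3) (by norm_num)
  have heq : ∑ m ∈ Finset.range 3, (t * X ω * Complex.I : ℂ) ^ m / (m.factorial : ℂ)
      = (1 : ℂ) + t * Complex.I * (X ω : ℂ) - (t ^ 2 / 2 : ℂ) * ((X ω ^ 2 : ℝ) : ℂ) := by
    simp only [Finset.sum_range_succ, Finset.sum_range_zero, Nat.factorial]
    push_cast
    linear_combination (t ^ 2 * X ω ^ 2 / 2 : ℂ) * Complex.I_sq
  rw [heq, hx] at key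
  refine key.trans ?_
  -- The cubic Taylor remainder is traded for a multiple of the variance, so that the errors add up
  -- to a multiple of the total variance.
  have h3 : |X ω| ^ 3 ≤ X ω ^ 2 := by
    rw [← sq_abs (X ω)]
    exact pow_le_pow_of_le_one (abs_nonneg _) (hb ω) (by norm_num)
  have hc : ((Nat.succ 3 : ℕ) : ℝ) * ((Nat.factorial 3 : ℝ) * (3 : ℕ))⁻¹ ≤ 1 := by
    norm_num [Nat.factorial]
  calc (|t| * |X ω|) ^ 3 * (((Nat.succ 3 : ℕ) : ℝ) * ((Nat.factorial 3 : ℝ) * (3 : ℕ))⁻¹)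
      ≤ (|t| * |X ω|) ^ 3 * 1 := by gcongr
    _ = |t| ^ 3 * |X ω| ^ 3 := by ring
    _ ≤ |t| ^ 3 * X ω ^ 2 := by gcongr

theorem abs_exp_neg_sub_le {x : ℝ} (h0 : 0 ≤ x) (h1 : x ≤ 1) :
    |1 - x - Real.exp (-x)| ≤ x ^ 2 := by
  have h := Real.abs_exp_sub_one_sub_id_le (x := -x) (by rwa [abs_neg, abs_of_nonneg h0])
  rw [abs_sub_comm]
  have e : Real.exp (-x) - (1 - x) = Real.exp (-x) - 1 - -x := by ring
  rw [e]
  simpa using h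

/-- **Central limit theorem** for independent, centred random variables bounded by `1`, along a
sequence of partial sums with normalization tending to `0`. -/
theorem tendstoInDistribution_mul_sum_of_abs_le_one {X : ℕ → Ω → ℝ}
    (hX : ∀ j, Measurable (X j)) (hb : ∀ j ω, |X j ω| ≤ 1) (h0 : ∀ j, ∫ ω, X j ω ∂μ = 0)
    (hind : iIndepFun X μ) (M : ℕ → ℕ) (b : ℕ → ℝ) (hb0 : Tendsto b atTop (nhds 0))
    (hV : Tendsto (fun N => b N ^ 2 * ∑ j ∈ Finset.range (M N), ∫ ω, X j ω ^ 2 ∂μ)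
      atTop (nhds 1)) :
    TendstoInDistribution (fun N ω => b N * ∑ j ∈ Finset.range (M N), X j ω) atTop (id : ℝ → ℝ)
      (fun _ => μ) (gaussianReal 0 1) where
  forall_aemeasurable N :=
    ((Finset.measurable_sum _ fun j _ => hX j).const_mul _).aemeasurable
  aemeasurable_limit := aemeasurable_id
  tendsto := by
    refine ProbabilityMeasure.tendsto_iff_tendsto_charFun.2 fun t => ?_
    set v : ℕ → ℝ := fun j => ∫ ω, X j ω ^ 2 ∂μ with hv
    set V : ℕ → ℝ := fun N => ∑ j ∈ Finset.range (M N), v j with hVdef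
    have hv0 : ∀ j, 0 ≤ v j := fun j => integral_nonneg fun ω => sq_nonneg _
    have hv1 : ∀ j, v j ≤ 1 := fun j => by
      have hsq : ∀ ω, X j ω ^ 2 ≤ 1 := fun ω => by
        rw [← sq_abs]; exact pow_le_one₀ (abs_nonneg _) (hb j ω)
      calc v j ≤ ∫ _, (1 : ℝ) ∂μ := integral_mono
            (integrable_of_abs_le ((hX j).pow_const 2) (B := 1) fun ω => by
              rw [abs_of_nonneg (sq_nonneg _)]; exact hsq ω)
            (integrable_const _) hsq
        _ = 1 := by simp
    have hcf : ∀ N, charFun (μ.map (fun ω => b N * ∑ j ∈ Finset.range (M N), X j ω)) t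
        = ∏ j ∈ Finset.range (M N), charFun (μ.map (X j)) (b N * t) := by
      intro N
      rw [charFun_map_mul_comp,
        (hind.restrict _).charFun_map_fun_finsetSum_eq_prod (fun j _ => (hX j).aemeasurable)]
      · simp
      · exact (Finset.measurable_sum _ fun j _ => hX j).aemeasurable
    have hexp : ∀ N, ∏ j ∈ Finset.range (M N), ((Real.exp (-((b N * t) ^ 2 * v j / 2)) : ℝ) : ℂ)
        = ((Real.exp (-(t ^ 2 / 2 * (b N ^ 2 * V N))) : ℝ) : ℂ) := by
      intro N
      rw [← Complex.ofReal_prod, ← Real.exp_sum]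
      congr 2
      rw [hVdef]
      simp only [Finset.mul_sum, ← Finset.sum_neg_distrib]
      exact Finset.sum_congr rfl fun j _ => by ring
    have hlim : Tendsto (fun N => ((Real.exp (-(t ^ 2 / 2 * (b N ^ 2 * V N))) : ℝ) : ℂ)) atTop
        (nhds ((Real.exp (-(t ^ 2 / 2 * 1)) : ℝ) : ℂ)) :=
      (Complex.continuous_ofReal.tendsto _).comp
        ((Real.continuous_exp.tendsto _).comp ((hV.const_mul (t ^ 2 / 2)).neg))
    have hbt : Tendsto (fun N => b N * t) atTop (nhds 0) := by simpa using hb0.mul_const t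
    have hsmall : ∀ᶠ N in atTop, |b N * t| ≤ 1 :=
      hbt.abs.eventually_le_const (by simp)
    have hdiff : Tendsto (fun N => ∏ j ∈ Finset.range (M N), charFun (μ.map (X j)) (b N * t)
        - ((Real.exp (-(t ^ 2 / 2 * (b N ^ 2 * V N))) : ℝ) : ℂ)) atTop (nhds 0) := by
      -- The factor errors add up to at most $2|bt|^3 V = 2|bt|\,t^2\,(b^2 V)$, with $b \to 0$ and
      -- $b^2 V \to 1$.
      have hz : Tendsto (fun N => 2 * (|b N * t| * t ^ 2 * (b N ^ 2 * V N))) atTop (nhds 0) := by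
        have := (((hbt.abs.mul_const (t ^ 2)).mul hV).const_mul 2)
        simpa using this
      refine squeeze_zero_norm' ?_ hz
      filter_upwards [hsmall] with N hN
      have hN2 : (b N * t) ^ 2 ≤ 1 := by
        rw [← sq_abs]; exact pow_le_one₀ (abs_nonneg _) hN
      rw [← hexp]
      refine (norm_prod_sub_prod_le_sum _ _ _ (fun j _ => ?_) (fun j _ => ?_)).trans ?_
      · have := Measure.isProbabilityMeasure_map (μ := μ) (hX j).aemeasurable
        exact norm_charFun_le_one _
      · rw [Complex.norm_real, Real.norm_eq_abs, abs_of_pos (Real.exp_pos _),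
          Real.exp_le_one_iff]
        have := hv0 j
        have := mul_nonneg (sq_nonneg (b N * t)) this
        linarith
      · have hterm : ∀ j ∈ Finset.range (M N), ‖charFun (μ.map (X j)) (b N * t)
            - ((Real.exp (-((b N * t) ^ 2 * v j / 2)) : ℝ) : ℂ)‖ ≤ 2 * |b N * t| ^ 3 * v j := by
          intro j _
          have h1 := norm_charFun_map_sub_le (hX j) (hb j) (h0 j) hN
          have hx0 : 0 ≤ (b N * t) ^ 2 * v j / 2 := by
            have := mul_nonneg (sq_nonneg (b N * t)) (hv0 j)
            linarith
          have hx1 : (b N * t) ^ 2 * v j / 2 ≤ 1 := by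
            have := mul_le_one₀ hN2 (hv0 j) (hv1 j)
            linarith
          have h2 := abs_exp_neg_sub_le hx0 hx1
          have h3 : ((b N * t) ^ 2 * v j / 2) ^ 2 ≤ |b N * t| ^ 3 * v j := by
            have e : ((b N * t) ^ 2 * v j / 2) ^ 2 = |b N * t| ^ 3 * v j * (|b N * t| * v j) / 4 := by
              rw [← sq_abs (b N * t)]; ring
            have h4 : |b N * t| * v j ≤ 1 := mul_le_one₀ hN (hv0 j) (hv1 j)
            have h5 : 0 ≤ |b N * t| ^ 3 * v j := mul_nonneg (by positivity) (hv0 j)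
            rw [e]
            nlinarith [mul_le_mul_of_nonneg_left h4 h5]
          calc _ ≤ ‖charFun (μ.map (X j)) (b N * t) - ((1 - (b N * t) ^ 2 * v j / 2 : ℝ) : ℂ)‖
                + ‖((1 - (b N * t) ^ 2 * v j / 2 : ℝ) : ℂ)
                  - ((Real.exp (-((b N * t) ^ 2 * v j / 2)) : ℝ) : ℂ)‖ :=
                norm_sub_le_norm_sub_add_norm_sub _ _ _
            _ ≤ |b N * t| ^ 3 * v j + |b N * t| ^ 3 * v j := by
                refine add_le_add h1 ?_
                rw [← Complex.ofReal_sub, Complex.norm_real, Real.norm_eq_abs]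
                exact h2.trans h3
            _ = _ := by ring
        refine (Finset.sum_le_sum hterm).trans (le_of_eq ?_)
        rw [← Finset.mul_sum]
        have : |b N * t| ^ 3 = |b N * t| * (b N * t) ^ 2 := by rw [← sq_abs (b N * t)]; ring
        rw [this]; ring
    have := hdiff.add hlim
    simp only [sub_add_cancel, zero_add] at this
    simp only [ProbabilityMeasure.coe_mk, hcf]
    convert! this using 2
    rw [Measure.map_id, charFun_gaussianReal]
    push_cast
    congr 1
    simp

end

/-! ### Predictable weights and second moments -/

/-- The σ-algebra generated by the variables of index less than `n`. -/
abbrev pastSigma {Ω : Type*} (Z : ℕ → Ω → ℝ) (n : ℕ) : MeasurableSpace Ω :=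
  ⨆ i ∈ Set.Iio n, MeasurableSpace.comap (Z i) inferInstance

theorem pastSigma_le {Ω : Type*} [MeasurableSpace Ω] {Z : ℕ → Ω → ℝ} (hZ : ∀ j, Measurable (Z j)) (n : ℕ) :
    pastSigma Z n ≤ ‹MeasurableSpace Ω› :=
  iSup₂_le fun i _ => (hZ i).comap_le

theorem pastSigma_mono {Ω : Type*} (Z : ℕ → Ω → ℝ) : Monotone (pastSigma Z) := fun _ _ h =>
  biSup_mono fun _ hi => lt_of_lt_of_le hi h

theorem comap_le_pastSigma {Ω : Type*} (Z : ℕ → Ω → ℝ) {i n : ℕ} (h : i < n) :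
    MeasurableSpace.comap (Z i) inferInstance ≤ pastSigma Z n :=
  le_biSup (fun i => MeasurableSpace.comap (Z i) inferInstance) (show i ∈ Set.Iio n from h)

theorem indep_pastSigma {Ω : Type*} [MeasurableSpace Ω] {μ : Measure Ω} {Z : ℕ → Ω → ℝ}
    (hZ : ∀ j, Measurable (Z j)) (hind : iIndepFun Z μ)
    (n : ℕ) : Indep (pastSigma Z n) (MeasurableSpace.comap (Z n) inferInstance) μ := by
  have h := indep_iSup_of_disjoint (fun i => (hZ i).comap_le) hind.iIndep
    (S := Set.Iio n) (T := {n}) (by simp)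
  rw [iSup_singleton] at h
  exact h

section

variable {Ω : Type*} [MeasurableSpace Ω] {μ : Measure Ω} [IsProbabilityMeasure μ]

/-- Sums of centred independent variables with predictable coefficients of size at most `1` have
second moment at most the sum of the variances. -/
theorem integral_sq_sum_predictable_le {Z X H : ℕ → Ω → ℝ} (hZ : ∀ j, Measurable (Z j))
    (hind : iIndepFun Z μ)
    (hX : ∀ j, Measurable[MeasurableSpace.comap (Z j) inferInstance] (X j))
    (hXb : ∀ j ω, |X j ω| ≤ 1) (hX0 : ∀ j, ∫ ω, X j ω ∂μ = 0)
    (hH : ∀ j, Measurable[pastSigma Z j] (H j)) (hHb : ∀ j ω, |H j ω| ≤ 1) {a b : ℕ}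
    (hab : a ≤ b) :
    ∫ ω, (∑ j ∈ Finset.Ico a b, H j ω * X j ω) ^ 2 ∂μ
      ≤ ∑ j ∈ Finset.Ico a b, ∫ ω, X j ω ^ 2 ∂μ := by
  have hXm : ∀ j, Measurable (X j) := fun j => (hX j).mono (hZ j).comap_le le_rfl
  have hHm : ∀ j, Measurable (H j) := fun j => (hH j).mono (pastSigma_le hZ j) le_rfl
  have hHX : ∀ j ω, |H j ω * X j ω| ≤ 1 := fun j ω => by
    rw [abs_mul]; exact mul_le_one₀ (hHb j ω) (abs_nonneg _) (hXb j ω)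
  induction b, hab using Nat.le_induction with
  | base => simp
  | succ b hab ih =>
    set S : Ω → ℝ := fun ω => ∑ j ∈ Finset.Ico a b, H j ω * X j ω with hS
    have hSp : Measurable[pastSigma Z b] S := by
      refine Finset.measurable_sum _ fun j hj => ?_
      have hjb := (Finset.mem_Ico.1 hj).2
      exact ((hH j).mono (pastSigma_mono Z hjb.le) le_rfl).mul
        ((hX j).mono (comap_le_pastSigma Z hjb) le_rfl)
    have hSm : Measurable S := hSp.mono (pastSigma_le hZ b) le_rfl
    have hSb : ∀ ω, |S ω| ≤ (Finset.Ico a b).card := fun ω => by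
      refine (Finset.abs_sum_le_sum_abs _ _).trans ?_
      refine (Finset.sum_le_sum fun j _ => hHX j ω).trans ?_
      simp
    -- Martingale orthogonality: `S * H b` depends only on indices below `b`, hence is independent
    -- of the centred variable `X b`.
    have hcross : ∫ ω, (S ω * H b ω) * X b ω ∂μ = 0 := by
      have hi : IndepFun (fun ω => S ω * H b ω) (X b) μ := by
        rw [IndepFun_iff_Indep]
        exact indep_of_indep_of_le_left (indep_of_indep_of_le_right (indep_pastSigma hZ hind b)
          (hX b).comap_le) (hSp.mul (hH b)).comap_le
      rw [hi.integral_fun_mul_eq_mul_integral (hSm.mul (hHm b)).aestronglyMeasurable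
        (hXm b).aestronglyMeasurable, hX0, mul_zero]
    have hsq : ∀ (f : Ω → ℝ), Measurable f → ∀ K : ℝ, (∀ ω, |f ω| ≤ K) →
        Integrable (fun ω => f ω ^ 2) μ := fun f hf K hK =>
      integrable_of_abs_le (hf.pow_const 2) (B := K ^ 2) fun ω => by
        rw [abs_pow]; exact pow_le_pow_left₀ (abs_nonneg _) (hK ω) 2
    have hI1 := hsq S hSm _ hSb
    have hI2 := hsq (fun ω => H b ω * X b ω) ((hHm b).mul (hXm b)) 1 (hHX b)
    have hI3 : Integrable (fun ω => (S ω * H b ω) * X b ω) μ :=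
      integrable_of_abs_le ((hSm.mul (hHm b)).mul (hXm b)) (B := (Finset.Ico a b).card)
        fun ω => by
          rw [mul_assoc, abs_mul]
          exact (mul_le_of_le_one_right (abs_nonneg _) (hHX b ω)).trans (hSb ω)
    have hexp : ∀ ω, (∑ j ∈ Finset.Ico a (b + 1), H j ω * X j ω) ^ 2
        = S ω ^ 2 + 2 * ((S ω * H b ω) * X b ω) + (H b ω * X b ω) ^ 2 := fun ω => by
      rw [Finset.sum_Ico_succ_top hab]; ring
    simp_rw [hexp]
    rw [integral_add (f := fun ω => S ω ^ 2 + 2 * ((S ω * H b ω) * X b ω))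
      (hI1.add (hI3.const_mul 2)) hI2, integral_add hI1 (hI3.const_mul 2),
      integral_const_mul, hcross, mul_zero, add_zero, Finset.sum_Ico_succ_top hab]
    refine add_le_add ih (integral_mono hI2 (hsq _ (hXm b) 1 (hXb b)) fun ω => ?_)
    have h1 : H b ω ^ 2 ≤ 1 := by rw [← sq_abs]; exact pow_le_one₀ (abs_nonneg _) (hHb b ω)
    simp only [mul_pow]
    nlinarith [sq_nonneg (X b ω)]

theorem measureReal_le_abs_le {f : Ω → ℝ} (hf : Measurable f) {K : ℝ} (hK : ∀ ω, |f ω| ≤ K)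
    {ε : ℝ} (hε : 0 < ε) : μ.real {ω | ε ≤ |f ω|} ≤ (∫ ω, f ω ^ 2 ∂μ) / ε ^ 2 := by
  have hset : {ω | ε ≤ |f ω|} = {ω | ε ^ 2 ≤ f ω ^ 2} := by
    ext ω
    simp only [Set.mem_ofPred_eq]
    rw [← sq_abs (f ω)]
    exact (pow_le_pow_iff_left₀ hε.le (abs_nonneg _) two_ne_zero).symm
  rw [hset, le_div_iff₀ (by positivity), mul_comm]
  exact mul_meas_ge_le_integral_of_nonneg (ae_of_all _ fun ω => sq_nonneg _)
    (integrable_of_abs_le (hf.pow_const 2) (B := K ^ 2) fun ω => by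
      rw [abs_pow]; exact pow_le_pow_left₀ (abs_nonneg _) (hK ω) 2) _

end

/-! ### Stopping at the N-th success -/

/-- A divergent series with terms in `[0, 1]` has, for every `x ≥ 0`, a partial sum in
`[x, x + 1]`. -/
theorem exists_sum_range_mem_Icc {q : ℕ → ℝ} (hq1 : ∀ j, q j ≤ 1)
    (hL : Tendsto (fun M => ∑ j ∈ Finset.range M, q j) atTop atTop) {x : ℝ} (hx : 0 ≤ x) :
    ∃ M, ∑ j ∈ Finset.range M, q j ∈ Set.Icc x (x + 1) := by
  classical
  have hex : ∃ M, x ≤ ∑ j ∈ Finset.range M, q j := (hL.eventually_ge_atTop x).exists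
  -- At the first index where the partial sum reaches `x`, the overshoot is at most the last term,
  -- hence at most 1.
  refine ⟨Nat.find hex, Nat.find_spec hex, ?_⟩
  rcases h : Nat.find hex with _ | m
  · simp; linarith
  · have := Nat.find_min hex (m := m) (by omega)
    rw [Finset.sum_range_succ]
    linarith [hq1 m]

/-- The indicator that fewer than `N` of the variables of index less than `j` are successes. -/
noncomputable def fewerThan {Ω : Type*} (Z : ℕ → Ω → ℝ) (N j : ℕ) (ω : Ω) : ℝ :=
  Set.indicator {ω | ∑ i ∈ Finset.range j, Z i ω < N} 1 ω

theorem fewerThan_of_lt {Ω : Type*} {Z : ℕ → Ω → ℝ} {N j : ℕ} {ω : Ω}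
    (h : ∑ i ∈ Finset.range j, Z i ω < N) : fewerThan Z N j ω = 1 :=
  Set.indicator_of_mem (s := {ω | ∑ i ∈ Finset.range j, Z i ω < N}) h 1

theorem fewerThan_of_le {Ω : Type*} {Z : ℕ → Ω → ℝ} {N j : ℕ} {ω : Ω}
    (h : (N : ℝ) ≤ ∑ i ∈ Finset.range j, Z i ω) : fewerThan Z N j ω = 0 :=
  Set.indicator_of_notMem (s := {ω | ∑ i ∈ Finset.range j, Z i ω < N}) (not_lt.2 h) 1

theorem abs_fewerThan_le {Ω : Type*} (Z : ℕ → Ω → ℝ) (N j : ℕ) (ω : Ω) :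
    |fewerThan Z N j ω| ≤ 1 := by
  rcases lt_or_ge (∑ i ∈ Finset.range j, Z i ω) (N : ℝ) with h | h
  · simp [fewerThan_of_lt h]
  · simp [fewerThan_of_le h]

/-- Only successes strictly before `j` are counted. The weight is therefore predictable, and the
`N`-th success itself still has weight 1. -/
theorem measurable_fewerThan {Ω : Type*} (Z : ℕ → Ω → ℝ) (N j : ℕ) :
    Measurable[pastSigma Z j] (fewerThan Z N j) := by
  have hsum : Measurable[pastSigma Z j] (fun ω => ∑ i ∈ Finset.range j, Z i ω) := by
    refine Finset.measurable_sum _ fun i hi => ?_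
    exact (comap_measurable (Z i)).mono (comap_le_pastSigma Z (Finset.mem_range.1 hi)) le_rfl
  let _ := pastSigma Z j
  exact Measurable.indicator (f := fun _ => (1 : ℝ)) measurable_const
    (hsum (measurableSet_Iio (a := (N : ℝ))))

/-- A sum weighted by `fewerThan` is a partial sum. -/
theorem exists_sum_fewerThan_mul_eq {Ω : Type*} {Z : ℕ → Ω → ℝ} {ω : Ω} (hZ : ∀ j, 0 ≤ Z j ω)
    (N M : ℕ) (g : ℕ → ℝ) :
    ∃ t, ∑ j ∈ Finset.range M, fewerThan Z N j ω * g j = ∑ j ∈ Finset.range t, g j := by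
  induction M with
  | zero => exact ⟨0, by simp⟩
  | succ M ih =>
    rw [Finset.sum_range_succ]
    rcases lt_or_ge (∑ i ∈ Finset.range M, Z i ω) (N : ℝ) with h | h
    · refine ⟨M + 1, ?_⟩
      rw [Finset.sum_range_succ, fewerThan_of_lt h, one_mul]
      congr 1
      refine Finset.sum_congr rfl fun j hj => ?_
      rw [fewerThan_of_lt, one_mul]
      refine lt_of_le_of_lt (Finset.sum_le_sum_of_subset_of_nonneg ?_ fun i _ _ => hZ i) h
      exact Finset.range_mono (Finset.mem_range.1 hj).le
    · rw [fewerThan_of_le h, zero_mul, add_zero]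
      exact ih

/-! ### Chebyshev bounds for Bernoulli trials -/

section

variable {Ω : Type*} [MeasurableSpace Ω] {μ : Measure Ω} [IsProbabilityMeasure μ]

theorem integral_sq_centred_bernoulli {Z : Ω → ℝ} (hZ : Measurable Z)
    (h01 : ∀ ω, Z ω = 0 ∨ Z ω = 1) {q : ℝ} (hq : ∫ ω, Z ω ∂μ = q) (c : ℝ) :
    ∫ ω, ((Z ω - q) * c) ^ 2 ∂μ = q * (1 - q) * c ^ 2 := by
  have hi : Integrable Z μ := integrable_of_abs_le hZ (B := 1) fun ω => by
    rcases h01 ω with h | h <;> simp [h]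
  -- Since $Z^2 = Z$, the square is affine in $Z$.
  have e : ∀ ω, ((Z ω - q) * c) ^ 2 = (1 - 2 * q) * c ^ 2 * Z ω + q ^ 2 * c ^ 2 := fun ω => by
    rcases h01 ω with h | h <;> rw [h] <;> ring
  simp_rw [e]
  rw [integral_add (hi.const_mul _) (integrable_const _), integral_const_mul, hq]
  simp
  ring

/-- **Chebyshev's inequality** for weighted sums of centred Bernoulli variables with predictable
coefficients. -/
theorem measureReal_le_abs_sum_sub_le {Z : ℕ → Ω → ℝ} (hZ : ∀ j, Measurable (Z j))
    (h01 : ∀ j ω, Z j ω = 0 ∨ Z j ω = 1) (hind : iIndepFun Z μ) {q : ℕ → ℝ}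
    (hq : ∀ j, ∫ ω, Z j ω ∂μ = q j) (hq0 : ∀ j, 0 ≤ q j) (hq1 : ∀ j, q j ≤ 1)
    {c : ℕ → ℝ} (hc : ∀ j, |c j| ≤ 1) {H : ℕ → Ω → ℝ}
    (hH : ∀ j, Measurable[pastSigma Z j] (H j)) (hHb : ∀ j ω, |H j ω| ≤ 1) {a b : ℕ}
    (hab : a ≤ b) {ε : ℝ} (hε : 0 < ε) :
    μ.real {ω | ε ≤ |∑ j ∈ Finset.Ico a b, H j ω * ((Z j ω - q j) * c j)|}
      ≤ (∑ j ∈ Finset.Ico a b, q j) / ε ^ 2 := by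
  have hXb : ∀ j ω, |(Z j ω - q j) * c j| ≤ 1 := fun j ω => by
    rw [abs_mul]
    refine mul_le_one₀ ?_ (abs_nonneg _) (hc j)
    rcases h01 j ω with h | h <;> rw [h, abs_le] <;> constructor <;> linarith [hq0 j, hq1 j]
  have hZi : ∀ j, Integrable (Z j) μ := fun j => integrable_of_abs_le (hZ j) (B := 1) fun ω => by
    rcases h01 j ω with h | h <;> simp [h]
  have hX0 : ∀ j, ∫ ω, (Z j ω - q j) * c j ∂μ = 0 := fun j => by
    rw [integral_mul_const, integral_sub (hZi j) (integrable_const _), hq]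
    simp
  have hXm : ∀ j, Measurable[MeasurableSpace.comap (Z j) inferInstance]
      (fun ω => (Z j ω - q j) * c j) := fun j =>
    ((comap_measurable (Z j)).sub_const _).mul_const _
  have hm : Measurable (fun ω => ∑ j ∈ Finset.Ico a b, H j ω * ((Z j ω - q j) * c j)) :=
    Finset.measurable_sum _ fun j _ =>
      ((hH j).mono (pastSigma_le hZ j) le_rfl).mul (((hZ j).sub_const _).mul_const _)
  refine (measureReal_le_abs_le hm (K := ∑ j ∈ Finset.Ico a b, 1) (fun ω => ?_) hε).trans ?_
  · refine (Finset.abs_sum_le_sum_abs _ _).trans (Finset.sum_le_sum fun j _ => ?_)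
    rw [abs_mul]; exact mul_le_one₀ (hHb j ω) (abs_nonneg _) (hXb j ω)
  · gcongr
    refine (integral_sq_sum_predictable_le hZ hind hXm hXb hX0 hH hHb hab).trans ?_
    refine Finset.sum_le_sum fun j _ => ?_
    rw [integral_sq_centred_bernoulli (hZ j) (h01 j) (hq j)]
    have hc2 : c j ^ 2 ≤ 1 := by rw [← sq_abs]; exact pow_le_one₀ (abs_nonneg _) (hc j)
    have h1 : q j * (1 - q j) ≤ q j := by nlinarith [hq0 j]
    have h2 : 0 ≤ q j * (1 - q j) := mul_nonneg (hq0 j) (by linarith [hq1 j])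
    nlinarith [sq_nonneg (c j)]

/-- Bound on the contribution of the random number of terms: outside a set of small measure, the
sum up to the `N`-th success differs from the centred sum over `range a` by at most `B` plus a
small random term. -/
theorem measureReal_stopped_sub_le {Z : ℕ → Ω → ℝ} (hZ : ∀ j, Measurable (Z j))
    (h01 : ∀ j ω, Z j ω = 0 ∨ Z j ω = 1) (hind : iIndepFun Z μ) {q : ℕ → ℝ}
    (hq : ∀ j, ∫ ω, Z j ω ∂μ = q j) (hq0 : ∀ j, 0 ≤ q j) (hq1 : ∀ j, q j ≤ 1)
    {c : ℕ → ℝ} (hc : ∀ j, |c j| ≤ 1) {B : ℝ}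
    (hB : ∀ M, |∑ j ∈ Finset.range M, q j * c j| ≤ B) {N : ℕ} {Y : Ω → ℝ}
    (hY : ∀ M ω, (N : ℝ) ≤ ∑ j ∈ Finset.range M, Z j ω →
      Y ω = ∑ j ∈ Finset.range M, fewerThan Z N j ω * (Z j ω * c j))
    {a e : ℕ} (hae : a ≤ e) {w w' : ℝ} (hw : 0 < w) (hw' : 0 < w')
    (ha : ∑ j ∈ Finset.range a, q j + w ≤ N) (he : (N : ℝ) + w' ≤ ∑ j ∈ Finset.range e, q j)
    {b ε : ℝ} (hb : 0 < b) (hε : 0 < ε) (hbB : b * B < ε / 2) :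
    μ.real {ω | ε ≤ |b * Y ω - b * ∑ j ∈ Finset.range a, (Z j ω - q j) * c j|}
      ≤ (∑ j ∈ Finset.range a, q j) / w ^ 2 + (∑ j ∈ Finset.range e, q j) / w' ^ 2
        + b ^ 2 * (∑ j ∈ Finset.Ico a e, q j) * (4 / ε ^ 2) := by
  have hcount : ∀ (M : ℕ) {x : ℝ}, 0 < x →
      μ.real {ω | x ≤ |∑ j ∈ Finset.range M, (Z j ω - q j)|}
        ≤ (∑ j ∈ Finset.range M, q j) / x ^ 2 := fun M x hx => by
    have := measureReal_le_abs_sum_sub_le hZ h01 hind hq hq0 hq1 (c := fun _ => 1) (by simp)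
      (H := fun _ _ => 1) (fun _ => measurable_const) (by simp) (Nat.zero_le M) hx
    simpa using this
  -- After multiplication by `b` this threshold is `ε / 2`; the other half of `ε` absorbs the drift,
  -- at most `b * B`.
  have hD := measureReal_le_abs_sum_sub_le hZ h01 hind hq hq0 hq1 hc (measurable_fewerThan Z N)
    (abs_fewerThan_le Z N) hae (ε := ε / (2 * b)) (by positivity)
  have hDe : (∑ j ∈ Finset.Ico a e, q j) / (ε / (2 * b)) ^ 2
      = b ^ 2 * (∑ j ∈ Finset.Ico a e, q j) * (4 / ε ^ 2) := by
    field_simp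
    ring
  rw [hDe] at hD
  refine le_trans (measureReal_mono (s₂ := ({ω | w ≤ |∑ j ∈ Finset.range a, (Z j ω - q j)|} ∪
    {ω | w' ≤ |∑ j ∈ Finset.range e, (Z j ω - q j)|}) ∪
    {ω | ε / (2 * b) ≤ |∑ j ∈ Finset.Ico a e, fewerThan Z N j ω * ((Z j ω - q j) * c j)|}) ?_)
    ((measureReal_union_le _ _).trans (add_le_add ((measureReal_union_le _ _).trans
      (add_le_add (hcount a hw) (hcount e hw'))) hD))
  intro ω hω
  by_contra hcon
  simp only [Set.mem_union, Set.mem_ofPred_eq, not_or, not_le] at hcon hω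
  obtain ⟨⟨h1, h2⟩, h3⟩ := hcon
  have hZ0 : ∀ j, 0 ≤ Z j ω := fun j => by rcases h01 j ω with h | h <;> simp [h]
  rw [Finset.sum_sub_distrib, abs_lt] at h1 h2
  have hNe : (N : ℝ) ≤ ∑ j ∈ Finset.range e, Z j ω := by linarith
  have hNa : ∑ j ∈ Finset.range a, Z j ω < N := by linarith
  -- The stopped drift is an ordinary partial sum up to a random `t`, so the uniform bound `B`
  -- applies to it.
  obtain ⟨t, ht⟩ := exists_sum_fewerThan_mul_eq (Z := Z) hZ0 N e (fun j => q j * c j)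
  have hYe : Y ω = ∑ j ∈ Finset.range a, (Z j ω - q j) * c j
      + ∑ j ∈ Finset.Ico a e, fewerThan Z N j ω * ((Z j ω - q j) * c j)
      + ∑ j ∈ Finset.range t, q j * c j := by
    have hsplit : ∑ j ∈ Finset.range a, (Z j ω - q j) * c j
        = ∑ j ∈ Finset.range a, fewerThan Z N j ω * ((Z j ω - q j) * c j) := by
      refine Finset.sum_congr rfl fun j hj => ?_
      rw [fewerThan_of_lt, one_mul]
      refine lt_of_le_of_lt (Finset.sum_le_sum_of_subset_of_nonneg ?_ fun i _ _ => hZ0 i) hNa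
      exact Finset.range_mono (Finset.mem_range.1 hj).le
    rw [hY e ω hNe, hsplit, Finset.sum_range_add_sum_Ico _ hae, ← ht, ← Finset.sum_add_distrib]
    exact Finset.sum_congr rfl fun j _ => by ring
  have hdiff : b * Y ω - b * ∑ j ∈ Finset.range a, (Z j ω - q j) * c j
      = b * ∑ j ∈ Finset.Ico a e, fewerThan Z N j ω * ((Z j ω - q j) * c j)
        + b * ∑ j ∈ Finset.range t, q j * c j := by
    rw [hYe]; ring
  rw [hdiff] at hω
  have h4 := abs_add_le (b * ∑ j ∈ Finset.Ico a e, fewerThan Z N j ω * ((Z j ω - q j) * c j))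
    (b * ∑ j ∈ Finset.range t, q j * c j)
  rw [abs_mul, abs_mul, abs_of_pos hb] at h4
  have h5 : b * |∑ j ∈ Finset.range t, q j * c j| ≤ b * B := by gcongr; exact hB t
  have h6 : b * |∑ j ∈ Finset.Ico a e, fewerThan Z N j ω * ((Z j ω - q j) * c j)| < ε / 2 := by
    calc _ < b * (ε / (2 * b)) := by gcongr
      _ = ε / 2 := by field_simp
  linarith

end

/-! ### Central limit theorem at the N-th success -/

section

variable {Ω : Type*} [MeasurableSpace Ω] {μ : Measure Ω} [IsProbabilityMeasure μ]

/-- **Central limit theorem for the weighted number of successes up to the `N`-th success** in a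
sequence of independent Bernoulli trials. -/
theorem tendstoInDistribution_mul_stopped_sum {Z : ℕ → Ω → ℝ} (hZ : ∀ j, Measurable (Z j))
    (h01 : ∀ j ω, Z j ω = 0 ∨ Z j ω = 1) (hind : iIndepFun Z μ) {q : ℕ → ℝ}
    (hq : ∀ j, ∫ ω, Z j ω ∂μ = q j) (hq0 : ∀ j, 0 ≤ q j) (hq1 : ∀ j, q j ≤ 1)
    (hL : Tendsto (fun M => ∑ j ∈ Finset.range M, q j) atTop atTop)
    {c : ℕ → ℝ} (hc : ∀ j, |c j| ≤ 1) {B : ℝ}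
    (hB : ∀ M, |∑ j ∈ Finset.range M, q j * c j| ≤ B) {v : ℝ} (hv : 0 < v)
    (hvar : Tendsto (fun M => (∑ j ∈ Finset.range M, q j * (1 - q j) * c j ^ 2)
      / ∑ j ∈ Finset.range M, q j) atTop (nhds v))
    {b : ℕ → ℝ} (hb0 : ∀ N, 0 ≤ b N) (hb : Tendsto (fun N : ℕ => b N ^ 2 * N) atTop (nhds (1 / v)))
    {Y : ℕ → Ω → ℝ} (hYm : ∀ N, Measurable (Y N))
    (hY : ∀ᶠ N : ℕ in atTop, ∀ M ω, (N : ℝ) ≤ ∑ j ∈ Finset.range M, Z j ω →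
      Y N ω = ∑ j ∈ Finset.range M, fewerThan Z N j ω * (Z j ω * c j)) :
    TendstoInDistribution (fun N ω => b N * Y N ω) atTop (id : ℝ → ℝ)
      (fun _ => μ) (gaussianReal 0 1) := by
  set L : ℕ → ℝ := fun M => ∑ j ∈ Finset.range M, q j with hLdef
  have hLmono : Monotone L := fun m n h =>
    Finset.sum_le_sum_of_subset_of_nonneg (Finset.range_mono h) fun i _ _ => hq0 i
  have hLle : ∀ M, L M ≤ M := fun M => by
    calc L M ≤ ∑ j ∈ Finset.range M, (1 : ℝ) := Finset.sum_le_sum fun j _ => hq1 j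
      _ = M := by simp
  -- $u = N^{1/4}$. The half-width $u^3 = N^{3/4}$ used below exceeds the fluctuations of order
  -- $N^{1/2}$ but is $o(N)$.
  set u : ℕ → ℝ := fun N : ℕ => √√(N : ℝ) with hu
  have hu4 : ∀ N : ℕ, u N ^ 4 = N := fun N => by
    have : u N ^ 4 = ((u N) ^ 2) ^ 2 := by ring
    rw [this, hu, Real.sq_sqrt (Real.sqrt_nonneg _), Real.sq_sqrt (Nat.cast_nonneg _)]
  have hu0 : ∀ N, 0 ≤ u N := fun N => Real.sqrt_nonneg _
  have hutop : Tendsto u atTop atTop :=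
    Real.tendsto_sqrt_atTop.comp (Real.tendsto_sqrt_atTop.comp tendsto_natCast_atTop_atTop)
  have hex : ∀ x : ℝ, ∃ M, 0 ≤ x → L M ∈ Set.Icc x (x + 1) := fun x => by
    by_cases hx : 0 ≤ x
    · obtain ⟨M, hM⟩ := exists_sum_range_mem_Icc hq1 hL hx
      exact ⟨M, fun _ => hM⟩
    · exact ⟨0, fun h => absurd h hx⟩
  choose m hm using hex
  set α : ℕ → ℕ := fun N : ℕ => m (N - u N ^ 3) with hα
  set β : ℕ → ℕ := fun N : ℕ => m (N + u N ^ 3) with hβ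
  have hu2 : ∀ᶠ N in atTop, 2 ≤ u N := hutop.eventually_ge_atTop 2
  have hαL : ∀ᶠ N : ℕ in atTop, (N : ℝ) - u N ^ 3 ≤ L (α N) ∧ L (α N) ≤ N - u N ^ 3 + 1 := by
    filter_upwards [hu2] with N hN
    have : u N ^ 3 ≤ N := by
      rw [← hu4]; exact pow_le_pow_right₀ (by linarith) (by norm_num)
    exact hm _ (by linarith)
  have hβL : ∀ N : ℕ, (N : ℝ) + u N ^ 3 ≤ L (β N) ∧ L (β N) ≤ N + u N ^ 3 + 1 := fun N =>
    hm _ (by have := hu0 N; positivity)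
  have hLα : Tendsto (fun N : ℕ => L (α N) / N) atTop (nhds 1) := by
    have hinv : Tendsto (fun N => (u N)⁻¹) atTop (nhds 0) := tendsto_inv_atTop_zero.comp hutop
    have hl : Tendsto (fun N => 1 - (u N)⁻¹) atTop (nhds 1) := by
      simpa using hinv.const_sub 1
    have hr : Tendsto (fun N => 1 + (u N)⁻¹ ^ 4) atTop (nhds 1) := by
      simpa using (hinv.pow 4).const_add 1
    refine tendsto_of_tendsto_of_tendsto_of_le_of_le' hl hr ?_ ?_
    · filter_upwards [hαL, hu2] with N hN h2
      rw [← hu4 N] at hN ⊢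
      rw [le_div_iff₀ (by positivity)]
      refine le_trans (le_of_eq ?_) hN.1
      field_simp
    · filter_upwards [hαL, hu2] with N hN h2
      rw [← hu4 N] at hN ⊢
      rw [div_le_iff₀ (by positivity)]
      have e : (1 + (u N)⁻¹ ^ 4) * u N ^ 4 = u N ^ 4 + 1 := by field_simp
      have : 0 ≤ u N ^ 3 := by positivity
      linarith [hN.2]
  have hNtop : Tendsto (fun N : ℕ => (N : ℝ)) atTop atTop := tendsto_natCast_atTop_atTop
  have hαtop : Tendsto α atTop atTop := by
    rw [← tendsto_natCast_atTop_iff (R := ℝ)]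
    refine tendsto_atTop_mono (fun N => hLle (α N)) ?_
    have := hLα.pos_mul_atTop one_pos hNtop
    refine this.congr' ?_
    filter_upwards [eventually_gt_atTop 0] with N hN
    have : (N : ℝ) ≠ 0 := by positivity
    field_simp
  have hb2 : Tendsto b atTop (nhds 0) := by
    have h1 : Tendsto (fun N => b N ^ 2) atTop (nhds 0) := by
      refine (hb.div_atTop hNtop).congr' ?_
      filter_upwards [eventually_gt_atTop 0] with N hN
      have : (N : ℝ) ≠ 0 := by positivity
      field_simp
    have h2 := h1.sqrt
    simp only [Real.sqrt_zero] at h2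
    exact h2.congr fun N => Real.sqrt_sq (hb0 N)
  have hbpos : ∀ᶠ N in atTop, 0 < b N := by
    have h0 : (0 : ℝ) < 1 / v := by positivity
    filter_upwards [hb.eventually_const_lt h0] with N hN
    refine lt_of_le_of_ne (hb0 N) fun h => ?_
    rw [← h] at hN
    simp at hN
  have hXb : ∀ j ω, |(Z j ω - q j) * c j| ≤ 1 := fun j ω => by
    rw [abs_mul]
    refine mul_le_one₀ ?_ (abs_nonneg _) (hc j)
    rcases h01 j ω with h | h <;> rw [h, abs_le] <;> constructor <;> linarith [hq0 j, hq1 j]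
  have hX0 : ∀ j, ∫ ω, (Z j ω - q j) * c j ∂μ = 0 := fun j => by
    have hZi : Integrable (Z j) μ := integrable_of_abs_le (hZ j) (B := 1) fun ω => by
      rcases h01 j ω with h | h <;> simp [h]
    rw [integral_mul_const, integral_sub hZi (integrable_const _), hq]
    simp
  have hclt : TendstoInDistribution
      (fun N ω => b N * ∑ j ∈ Finset.range (α N), (Z j ω - q j) * c j) atTop (id : ℝ → ℝ)
      (fun _ => μ) (gaussianReal 0 1) := by
    refine tendstoInDistribution_mul_sum_of_abs_le_one (X := fun j ω => (Z j ω - q j) * c j)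
      (fun j => ((hZ j).sub_const _).mul_const _) hXb hX0
      (hind.comp (fun j x => (x - q j) * c j) fun j => by fun_prop) α b hb2 ?_
    -- The normalized variance factors as $(\mathrm{Var}/L)\,(b^2 N)\,(L/N)$, all at the index `α
    -- N`.
    have h := (hvar.comp hαtop).mul (hb.mul hLα)
    have h1 : v * (1 / v * 1) = 1 := by field_simp
    rw [h1] at h
    refine h.congr' ?_
    filter_upwards [eventually_gt_atTop 0, (hL.comp hαtop).eventually_gt_atTop 0] with N hN hLN
    have hN' : (N : ℝ) ≠ 0 := by positivity
    have hLN' : ∑ j ∈ Finset.range (α N), q j ≠ 0 := ne_of_gt hLN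
    simp only [Function.comp, hLdef]
    simp_rw [fun j => integral_sq_centred_bernoulli (hZ j) (h01 j) (hq j) (c j)]
    field_simp
  -- Slutsky: it remains to show that the stopped sum and the deterministic one differ by a term
  -- tending to 0 in measure.
  refine tendstoInDistribution_of_tendstoInMeasure_sub _ _ hclt ?_
    fun N => ((hYm N).const_mul _).aemeasurable
  rw [tendstoInMeasure_iff_measureReal_norm]
  intro ε hε
  -- The 11 is 8 + 3, from the Chebyshev bounds at the two ends of the window; the last term comes
  -- from the variance inside it.
  have hlim : Tendsto (fun N : ℕ => 11 * (u N)⁻¹ ^ 2 + (b N ^ 2 * N) * (3 * (u N)⁻¹) * (4 / ε ^ 2))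
      atTop (nhds 0) := by
    have hinv : Tendsto (fun N => (u N)⁻¹) atTop (nhds 0) := tendsto_inv_atTop_zero.comp hutop
    have := ((hinv.pow 2).const_mul 11).add
      ((hb.mul (hinv.const_mul 3)).mul_const (4 / ε ^ 2))
    simpa using this
  refine squeeze_zero' (Eventually.of_forall fun N => measureReal_nonneg) ?_ hlim
  have hbB : ∀ᶠ N in atTop, b N * B < ε / 2 := by
    have h := hb2.mul_const B
    rw [zero_mul] at h
    exact h.eventually_lt_const (by positivity)
  filter_upwards [hY, hαL, hu2, hbpos, hbB] with N hYN hαN hN hbN hbBN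
  have hβN := hβL N
  have hu3 : 8 ≤ u N ^ 3 := by
    calc (8 : ℝ) = 2 ^ 3 := by norm_num
      _ ≤ u N ^ 3 := by gcongr
  have hαβ : α N ≤ β N := by
    by_contra hlt
    have := hLmono (le_of_not_ge hlt)
    linarith [hαN.2, hβN.1]
  -- The left margin loses 1 because `L (α N)` may overshoot its target by 1.
  have key := measureReal_stopped_sub_le (μ := μ) hZ h01 hind hq hq0 hq1 hc hB hYN hαβ
    (w := u N ^ 3 - 1) (w' := u N ^ 3) (by linarith) (by linarith)
    (show L (α N) + _ ≤ _ by linarith [hαN.2]) hβN.1 hbN hε hbBN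
  have hgoal : {ω | ε ≤ ‖((fun ω => b N * Y N ω)
      - fun ω => b N * ∑ j ∈ Finset.range (α N), (Z j ω - q j) * c j) ω - (0 : Ω → ℝ) ω‖}
      = {ω | ε ≤ |b N * Y N ω - b N * ∑ j ∈ Finset.range (α N), (Z j ω - q j) * c j|} := by
    simp
  refine (le_of_eq (congrArg _ hgoal)).trans (key.trans ?_)
  have hIco : ∑ j ∈ Finset.Ico (α N) (β N), q j = L (β N) - L (α N) :=
    Finset.sum_Ico_eq_sub _ hαβ
  rw [hIco]
  have hupos : 0 < u N := by linarith
  have h1 : L (α N) / (u N ^ 3 - 1) ^ 2 ≤ 8 * (u N)⁻¹ ^ 2 := by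
    have ha : L (α N) ≤ 2 * u N ^ 4 := by
      have : (1 : ℝ) ≤ u N ^ 4 := one_le_pow₀ (by linarith)
      have := hu4 N
      linarith [hαN.2]
    have hbb : u N ^ 6 / 4 ≤ (u N ^ 3 - 1) ^ 2 := by nlinarith
    calc _ ≤ 2 * u N ^ 4 / (u N ^ 6 / 4) := by gcongr
      _ = 8 * (u N)⁻¹ ^ 2 := by field_simp; norm_num
  have h2 : L (β N) / (u N ^ 3) ^ 2 ≤ 3 * (u N)⁻¹ ^ 2 := by
    have ha : L (β N) ≤ 3 * u N ^ 4 := by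
      have h34 : u N ^ 3 ≤ u N ^ 4 := pow_le_pow_right₀ (by linarith) (by norm_num)
      have := hu4 N
      linarith [hβN.2]
    calc _ ≤ 3 * u N ^ 4 / (u N ^ 3) ^ 2 := by gcongr
      _ = 3 * (u N)⁻¹ ^ 2 := by field_simp
  have h3 : b N ^ 2 * (L (β N) - L (α N)) * (4 / ε ^ 2)
      ≤ (b N ^ 2 * N) * (3 * (u N)⁻¹) * (4 / ε ^ 2) := by
    have ha : L (β N) - L (α N) ≤ N * (3 * (u N)⁻¹) := by
      have e : (N : ℝ) * (3 * (u N)⁻¹) = 3 * u N ^ 3 := by rw [← hu4]; field_simp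
      rw [e]
      linarith [hβN.2, hαN.1]
    rw [mul_assoc (b N ^ 2) (N : ℝ)]
    gcongr
  linarith

end

/-! ### Periodic sequences with mean zero -/

theorem ZMod.sum_range_natCast_add {k : ℕ} [NeZero k] (h : ZMod k → ℝ) (m : ZMod k) :
    ∑ j ∈ Finset.range k, h ((j : ZMod k) + m) = ∑ x, h x := by
  have h1 : ∑ x, h x = ∑ x : ZMod k, h (x + m) :=
    (Equiv.sum_comp (Equiv.addRight m) h).symm
  rw [h1]
  refine Finset.sum_nbij' (fun j => (j : ZMod k)) ZMod.val (by simp)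
    (fun x _ => by simpa using ZMod.val_lt x)
    (fun j hj => ZMod.val_cast_of_lt (by simpa using hj)) (fun x _ => ZMod.natCast_zmod_val x)
    (fun _ _ => rfl)

/-- A full period contributes 0, so the partial sums are themselves periodic and take finitely many
values. -/
theorem exists_abs_sum_natCast_add_le {k : ℕ} [NeZero k] (h : ZMod k → ℝ) (h0 : ∑ x, h x = 0)
    (m : ZMod k) : ∃ K, ∀ n, |∑ j ∈ Finset.range n, h ((j : ZMod k) + m)| ≤ K := by
  set F : ℕ → ℝ := fun n => ∑ j ∈ Finset.range n, h ((j : ZMod k) + m) with hF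
  have hper : Function.Periodic F k := fun n => by
    simp only [hF]
    rw [Finset.sum_range_add, add_eq_left]
    have := ZMod.sum_range_natCast_add h (n + m)
    rw [h0] at this
    rw [← this]
    refine Finset.sum_congr rfl fun j _ => ?_
    push_cast
    congr 1
    ring
  refine ⟨∑ n ∈ Finset.range k, |F n|, fun n => ?_⟩
  change |F n| ≤ _
  rw [← hper.map_mod_nat n]
  exact Finset.single_le_sum (f := fun n => |F n|) (fun i _ => abs_nonneg _)
    (Finset.mem_range.2 (Nat.mod_lt _ (NeZero.pos k)))

/-- **Dirichlet's test**, boundedness of the partial sums, for periodic sequences of mean zero. -/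
theorem exists_abs_sum_mul_natCast_add_le {k : ℕ} [NeZero k] (h : ZMod k → ℝ)
    (h0 : ∑ x, h x = 0) (m : ZMod k) {q : ℕ → ℝ} (hq : Antitone q)
    (hq0 : Tendsto q atTop (nhds 0)) :
    ∃ K, ∀ n, |∑ j ∈ Finset.range n, q j * h ((j : ZMod k) + m)| ≤ K := by
  obtain ⟨K, hK⟩ := exists_abs_sum_natCast_add_le h h0 m
  have hc := hq.cauchySeq_series_mul_of_tendsto_zero_of_bounded hq0
    (z := fun j : ℕ => h ((j : ZMod k) + m)) hK
  obtain ⟨K', hK'⟩ := isBounded_iff_forall_norm_le.1 hc.isBounded_range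
  exact ⟨K', fun n => hK' _ ⟨n, rfl⟩⟩

/-- The weighted mean of the variances `q (1 - q) h ^ 2` with respect to `q` tends to the mean
value `v` of `h ^ 2`. -/
theorem tendsto_sum_variance_div {k : ℕ} [NeZero k] (h : ZMod k → ℝ) {v : ℝ}
    (hv : ∑ x, (h x ^ 2 - v) = 0) (m : ZMod k) {q : ℕ → ℝ} (hq : Antitone q)
    (hq0 : Tendsto q atTop (nhds 0)) (hqpos : ∀ j, 0 ≤ q j)
    (hL : Tendsto (fun M => ∑ j ∈ Finset.range M, q j) atTop atTop) :
    Tendsto (fun M => (∑ j ∈ Finset.range M, q j * (1 - q j) * h ((j : ZMod k) + m) ^ 2)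
      / ∑ j ∈ Finset.range M, q j) atTop (nhds v) := by
  -- The numerator is $v\sum q + \sum q(h^2 - v) - \sum q^2 h^2$. The second sum is bounded by
  -- Dirichlet's test; the third is $o(\sum q)$ because $q \to 0$.
  obtain ⟨K, hK⟩ := exists_abs_sum_mul_natCast_add_le (fun x => h x ^ 2 - v) hv m hq hq0
  have h1 : Tendsto (fun M => (∑ j ∈ Finset.range M, q j * (h ((j : ZMod k) + m) ^ 2 - v))
      / ∑ j ∈ Finset.range M, q j) atTop (nhds 0) := by
    refine squeeze_zero_norm' ?_ (hL.const_div_atTop K)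
    filter_upwards [hL.eventually_gt_atTop 0] with M hM
    rw [norm_div, Real.norm_eq_abs, Real.norm_eq_abs, abs_of_pos hM]
    gcongr
    exact hK M
  obtain ⟨D, hD⟩ : ∃ D, ∀ x, h x ^ 2 ≤ D :=
    ⟨∑ x, h x ^ 2, fun x => Finset.single_le_sum (f := fun x => h x ^ 2)
      (fun i _ => sq_nonneg _) (Finset.mem_univ x)⟩
  have h2 : Tendsto (fun M => (∑ j ∈ Finset.range M, q j ^ 2 * h ((j : ZMod k) + m) ^ 2)
      / ∑ j ∈ Finset.range M, q j) atTop (nhds 0) := by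
    have ho : (fun j => q j ^ 2 * h ((j : ZMod k) + m) ^ 2) =o[atTop] q := by
      have hbig : (fun j : ℕ => q j * h ((j : ZMod k) + m) ^ 2) =O[atTop] q := by
        refine Asymptotics.IsBigO.of_bound D (Eventually.of_forall fun j => ?_)
        rw [norm_mul, mul_comm, Real.norm_of_nonneg (sq_nonneg _)]
        gcongr
        exact hD _
      have hlit : q =o[atTop] (fun _ => (1 : ℝ)) := (Asymptotics.isLittleO_one_iff ℝ).2 hq0
      have := hlit.mul_isBigO hbig
      simp only [one_mul] at this
      exact this.congr_left fun j => by ring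
    exact (ho.sum_range hqpos hL).tendsto_div_nhds_zero
  have h3 := (h1.sub h2).add_const v
  rw [sub_zero, zero_add] at h3
  refine h3.congr' ?_
  filter_upwards [hL.eventually_gt_atTop 0] with M hM
  have hM' := hM.ne'
  rw [← sub_div, div_add' _ _ _ hM', ← Finset.sum_sub_distrib, Finset.mul_sum,
    ← Finset.sum_add_distrib]
  congr 1
  exact Finset.sum_congr rfl fun j _ => by ring

/-! ### Mean values of Dirichlet characters -/

namespace DirichletCharacter

variable {k : ℕ} (χ : DirichletCharacter ℂ k)

theorem abs_re_le_one (x : ZMod k) : |(χ x).re| ≤ 1 :=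
  (Complex.abs_re_le_norm _).trans (χ.norm_le_one x)

/-- This absorbs both the angle and the coprimality condition into $\operatorname{Re}\chi$, which is
periodic. -/
theorem re_natCast_eq (n : ℕ) :
    (χ (n : ZMod k)).re = if n.Coprime k then Real.cos (CramerModel.theta χ n) else 0 := by
  split_ifs with h
  · have h1 : ‖χ (n : ZMod k)‖ = 1 := χ.unit_norm_eq_one (ZMod.unitOfCoprime n h)
    rw [CramerModel.theta, ← Complex.norm_mul_cos_arg, h1, one_mul]
  · rw [χ.map_nonunit (by rwa [ZMod.isUnit_iff_coprime]), Complex.zero_re]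

variable [NeZero k]

theorem sum_re_eq_zero {χ : DirichletCharacter ℂ k} (hχ : χ ≠ 1) : ∑ x, (χ x).re = 0 := by
  rw [← Complex.re_sum, MulChar.sum_eq_zero_of_ne_one hχ, Complex.zero_re]

theorem sum_norm_sq_eq : ∑ x, ‖χ x‖ ^ 2 = (Nat.totient k : ℝ) := by
  have h : ∀ x, ‖χ x‖ ^ 2 = (1 : MulChar (ZMod k) ℝ) x := fun x => by
    by_cases hx : IsUnit x
    · obtain ⟨u, rfl⟩ := hx
      rw [χ.unit_norm_eq_one, MulChar.one_apply_coe, one_pow]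
    · rw [χ.map_nonunit hx, MulChar.map_nonunit _ hx]
      simp
  simp_rw [h]
  rw [MulChar.sum_one_eq_card_units, ZMod.card_units_eq_totient]

/-- From $2(\operatorname{Re} w)^2 = \operatorname{Re}(w^2) + |w|^2$: for non-real $\chi$ the
character $\chi^2$ is non-principal, so its sum vanishes and half of $\sum|\chi|^2$ remains. -/
theorem sum_re_sq_eq : ∑ x, (χ x).re ^ 2 = CramerModel.a χ * (Nat.totient k : ℝ) := by
  rw [← sum_norm_sq_eq χ, CramerModel.a]
  split_ifs with hreal
  · rw [one_mul]
    refine Finset.sum_congr rfl fun x _ => ?_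
    rw [Complex.sq_norm, Complex.normSq_apply, hreal x]
    ring
  -- If $\chi^2$ were principal, the values of $\chi$ would be $0$ and $\pm 1$, all real.
  · have hne : χ ^ 2 ≠ 1 := by
      intro h
      refine hreal fun x => ?_
      by_cases hx : IsUnit x
      · have h1 : χ x ^ 2 = 1 := by
          rw [← MulChar.pow_apply' χ two_ne_zero, h, MulChar.one_apply hx]
        rcases sq_eq_sq_iff_eq_or_eq_neg.1 (h1.trans (one_pow 2).symm) with h2 | h2 <;> rw [h2] <;> simp
      · rw [χ.map_nonunit hx, Complex.zero_im]
    have h0 := sum_re_eq_zero hne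
    have h1 : ∀ x, ((χ ^ 2) x).re = 2 * (χ x).re ^ 2 - ‖χ x‖ ^ 2 := fun x => by
      rw [MulChar.pow_apply' χ two_ne_zero, Complex.sq_norm, Complex.normSq_apply, sq,
        Complex.mul_re]
      ring
    simp_rw [h1] at h0
    rw [Finset.sum_sub_distrib, ← Finset.mul_sum] at h0
    linarith

theorem sum_re_sq_sub_eq_zero : ∑ x, ((χ x).re ^ 2 - CramerModel.sSq χ) = 0 := by
  have hk : (k : ℝ) ≠ 0 := Nat.cast_ne_zero.2 (NeZero.ne k)
  rw [Finset.sum_sub_distrib, sum_re_sq_eq, CramerModel.sSq]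
  simp [ZMod.card]
  field_simp
  ring

theorem sSq_pos : 0 < CramerModel.sSq χ := by
  have hk := NeZero.pos k
  have h1 : (0 : ℝ) < Nat.totient k := Nat.cast_pos.2 (Nat.totient_pos.2 hk)
  have h2 : 0 < CramerModel.a χ := by
    rw [CramerModel.a]; split_ifs <;> norm_num
  rw [CramerModel.sSq]
  positivity

end DirichletCharacter

/-! ### The density `1 / log n` -/

/-- Since $e < 3$, the number $1/\log n$ is a genuine probability from $n = 3$ on. Trials are
indexed by `j = n - 3`. -/
theorem one_lt_log_add_three (j : ℕ) : 1 < Real.log ((j + 3 : ℕ) : ℝ) := by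
  rw [Real.lt_log_iff_exp_lt (by positivity)]
  refine Real.exp_one_lt_three.trans_le ?_
  push_cast
  linarith [Nat.cast_nonneg (α := ℝ) j]

theorem antitone_one_div_log_add_three :
    Antitone (fun j : ℕ => 1 / Real.log ((j + 3 : ℕ) : ℝ)) := fun i j h => by
  have := one_lt_log_add_three i
  refine one_div_le_one_div_of_le (by linarith) (Real.log_le_log (by positivity) ?_)
  exact_mod_cast Nat.add_le_add_right h 3

theorem tendsto_one_div_log_add_three :
    Tendsto (fun j : ℕ => 1 / Real.log ((j + 3 : ℕ) : ℝ)) atTop (nhds 0) :=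
  (Real.tendsto_log_atTop.comp
    (tendsto_natCast_atTop_atTop.comp (tendsto_add_atTop_nat 3))).const_div_atTop 1

theorem tendsto_sum_one_div_log_add_three :
    Tendsto (fun M => ∑ j ∈ Finset.range M, 1 / Real.log ((j + 3 : ℕ) : ℝ)) atTop atTop := by
  rw [← not_summable_iff_tendsto_nat_atTop_of_nonneg fun j =>
    one_div_nonneg.2 (zero_le_one.trans (one_lt_log_add_three j).le)]
  intro hs
  refine Real.not_summable_one_div_natCast ((summable_nat_add_iff 3).1 ?_)
  refine hs.of_nonneg_of_le (fun j => by positivity) fun j => ?_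
  have := one_lt_log_add_three j
  exact one_div_le_one_div_of_le (by linarith) (Real.log_le_self (Nat.cast_nonneg _))

theorem tendsto_normalization {v : ℝ} (hv : 0 < v) :
    Tendsto (fun N : ℕ =>
      √((1 + Real.log (Real.log N) / Real.log N) / (v * N)) ^ 2 * N) atTop (nhds (1 / v)) := by
  have h1 : Tendsto (fun N : ℕ => Real.log (Real.log N) / Real.log N) atTop (nhds 0) :=
    Real.isLittleO_log_id_atTop.tendsto_div_nhds_zero.comp
      (Real.tendsto_log_atTop.comp tendsto_natCast_atTop_atTop)
  have h2 := (h1.const_add 1).div_const v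
  rw [add_zero] at h2
  refine h2.congr' ?_
  -- The radicand must be nonnegative before the square cancels the root; this holds once the
  -- correction exceeds -1.
  filter_upwards [h1.eventually_const_lt (show (-1 : ℝ) < 0 by norm_num),
    eventually_gt_atTop 0] with N hN hN0
  have hN' : (0 : ℝ) < N := by positivity
  rw [Real.sq_sqrt (div_nonneg (by linarith) (by positivity))]
  field_simp

/-! ### Pseudo-primes as Bernoulli trials -/

namespace CramerModel

variable {Ω : Type*}

theorem z_eq_zero_or_one (r : ℕ → Ω → ℝ) (n : ℕ) (ω : Ω) : z r n ω = 0 ∨ z r n ω = 1 := by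
  unfold z; split_ifs <;> simp

theorem z_eq_zero_of_lt (r : ℕ → Ω → ℝ) {n : ℕ} (hn : n < 3) (ω : Ω) : z r n ω = 0 :=
  if_neg fun h => by omega

open Classical in
theorem count_eq_sum_z (r : ℕ → Ω → ℝ) (n : ℕ) (ω : Ω) :
    (Nat.count (fun n => z r n ω = 1) n : ℝ) = ∑ i ∈ Finset.range n, z r i ω := by
  induction n with
  | zero => simp
  | succ n ih =>
    rw [Nat.count_succ, Finset.sum_range_succ, ← ih]
    rcases z_eq_zero_or_one r n ω with h | h <;> simp [h]

open Classical in
theorem count_add_three_eq_sum_z (r : ℕ → Ω → ℝ) (n : ℕ) (ω : Ω) :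
    (Nat.count (fun n => z r n ω = 1) (n + 3) : ℝ) = ∑ j ∈ Finset.range n, z r (j + 3) ω := by
  rw [count_eq_sum_z, add_comm n 3, Finset.sum_range_add,
    Finset.sum_eq_zero fun i hi => z_eq_zero_of_lt r (Finset.mem_range.1 hi) ω, zero_add]
  exact Finset.sum_congr rfl fun j _ => by rw [add_comm]

theorem C_eq_sum_re {k : ℕ} (χ : DirichletCharacter ℂ k) (r : ℕ → Ω → ℝ) (N : ℕ) (ω : Ω) :
    C χ r N ω
      = ∑ n ∈ Finset.Icc 1 (pseudoPrime r N ω), z r n ω * (χ (n : ZMod k)).re := by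
  rw [C]
  refine Finset.sum_congr rfl fun n _ => ?_
  rw [χ.re_natCast_eq, zCoprime]
  split_ifs <;> simp

open Classical in
-- A success is among the first `N` exactly when fewer than `N` precede it. The hypothesis `hM`
-- ensures that the `N`-th success exists, so that `Nat.nth` does not return its default 0.
theorem le_pseudoPrime_iff {r : ℕ → Ω → ℝ} {N M : ℕ} {ω : Ω} (hN : 1 ≤ N)
    (hM : N ≤ Nat.count (fun n => z r n ω = 1) M) {n : ℕ} (hn : z r n ω = 1) :
    n ≤ pseudoPrime r N ω ↔ Nat.count (fun n => z r n ω = 1) n < N := by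
  rw [pseudoPrime]
  constructor
  · intro h
    have := Nat.le_nth_of_count_le h
    omega
  · intro h
    rw [← Nat.nth_count (p := fun n => z r n ω = 1) hn]
    exact Nat.nth_le_nth' (by omega) fun hf =>
      lt_of_lt_of_le (by omega) (hM.trans (Nat.count_le_card hf M))

/-- The sum up to the `N`-th pseudo-prime as a sum over a deterministic range. -/
theorem C_eq_sum_fewerThan {k : ℕ} (χ : DirichletCharacter ℂ k) {r : ℕ → Ω → ℝ} {N M : ℕ} {ω : Ω}
    (hN : 1 ≤ N) (hM : (N : ℝ) ≤ ∑ j ∈ Finset.range M, z r (j + 3) ω) :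
    C χ r N ω = ∑ j ∈ Finset.range M, fewerThan (fun j => z r (j + 3)) N j ω
      * (z r (j + 3) ω * (χ ((j + 3 : ℕ) : ZMod k)).re) := by
  classical
  rw [← count_add_three_eq_sum_z, Nat.cast_le] at hM
  have hlt : pseudoPrime r N ω < M + 3 := Nat.nth_lt_of_lt_count (by omega)
  have h1 : C χ r N ω = ∑ n ∈ Finset.range (3 + M),
      if n ≤ pseudoPrime r N ω then z r n ω * (χ (n : ZMod k)).re else 0 := by
    rw [C_eq_sum_re, ← Finset.sum_filter]
    refine Finset.sum_subset (fun n hn => ?_) fun n hn hn' => ?_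
    · rw [Finset.mem_Icc] at hn
      rw [Finset.mem_filter, Finset.mem_range]
      omega
    · rw [Finset.mem_filter, Finset.mem_range] at hn
      rw [Finset.mem_Icc] at hn'
      rw [z_eq_zero_of_lt r (by omega), zero_mul]
  rw [h1, Finset.sum_range_add, Finset.sum_eq_zero fun i hi => by
    rw [z_eq_zero_of_lt r (Finset.mem_range.1 hi), zero_mul, ite_self], zero_add]
  refine Finset.sum_congr rfl fun j _ => ?_
  rw [add_comm 3 j]
  rcases z_eq_zero_or_one r (j + 3) ω with h | h
  · simp [h]
  · by_cases hj : j + 3 ≤ pseudoPrime r N ω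
    · rw [if_pos hj, fewerThan_of_lt, one_mul]
      rw [← count_add_three_eq_sum_z, Nat.cast_lt]
      exact (le_pseudoPrime_iff hN hM h).1 hj
    · rw [if_neg hj, fewerThan_of_le, zero_mul]
      rw [← count_add_three_eq_sum_z, Nat.cast_le]
      exact not_lt.1 fun hc => hj ((le_pseudoPrime_iff hN hM h).2 hc)

section Measurability

variable [MeasurableSpace Ω] {r : ℕ → Ω → ℝ}

theorem measurable_z (hr : ∀ n, 3 ≤ n → Measurable (r n)) (n : ℕ) : Measurable (z r n) := by
  by_cases hn : 3 ≤ n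
  · refine Measurable.ite ?_ measurable_const measurable_const
    simp only [hn, true_and]
    exact hr n hn measurableSet_Iic
  · have : z r n = fun _ => 0 := funext fun ω => z_eq_zero_of_lt r (not_le.1 hn) ω
    rw [this]
    exact measurable_const

theorem measurable_pseudoPrime (hr : ∀ n, 3 ≤ n → Measurable (r n)) (N : ℕ) :
    Measurable (pseudoPrime r N) := by
  classical
  -- A nonzero value cannot be the default of `Nat.nth`, so it is described by a success there with
  -- `N - 1` successes before it. The value 0 is then handled as the complement.
  have hsucc : ∀ m, MeasurableSet {ω | pseudoPrime r N ω = m + 1} := fun m => by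
    have hset : {ω | pseudoPrime r N ω = m + 1} = {ω | z r (m + 1) ω = 1} ∩
        {ω | ∑ i ∈ Finset.range (m + 1), z r i ω = ((N - 1 : ℕ) : ℝ)} := by
      ext ω
      simp only [Set.mem_inter_iff, Set.mem_ofPred_eq, pseudoPrime]
      rw [← count_eq_sum_z, Nat.cast_inj]
      constructor
      · intro h
        have h0 : Nat.nth (fun n => z r n ω = 1) (N - 1) ≠ 0 := by omega
        have h1 := Nat.nth_mem_of_ne_zero h0
        have h2 := Nat.count_nth (fun hf => Nat.lt_card_toFinset_of_nth_ne_zero h0 hf)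
        rw [h] at h1 h2
        exact ⟨h1, h2⟩
      · rintro ⟨h1, h2⟩
        rw [← h2]
        exact Nat.nth_count (p := fun n => z r n ω = 1) h1
    rw [hset]
    exact (measurable_z hr _ (measurableSet_singleton 1)).inter
      ((Finset.measurable_sum _ fun i _ => measurable_z hr i) (measurableSet_singleton _))
  refine measurable_to_countable' fun m => ?_
  rcases m with _ | m
  · have hset : pseudoPrime r N ⁻¹' {0} = (⋃ m, {ω | pseudoPrime r N ω = m + 1})ᶜ := by
      ext ω
      simp only [Set.mem_preimage, Set.mem_singleton_iff, Set.mem_compl_iff, Set.mem_iUnion,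
        Set.mem_ofPred_eq, not_exists]
      exact ⟨fun h m => by omega, fun h => by
        by_contra h0
        exact h (pseudoPrime r N ω - 1) (by omega)⟩
    rw [hset]
    exact (MeasurableSet.iUnion hsucc).compl
  · exact hsucc m

theorem measurable_C (hr : ∀ n, 3 ≤ n → Measurable (r n)) {k : ℕ} (χ : DirichletCharacter ℂ k)
    (N : ℕ) : Measurable (C χ r N) := by
  -- The random upper limit is first made a free variable; joint measurability is automatic in the
  -- countable coordinate.
  have h : Measurable (fun p : ℕ × Ω =>
      ∑ n ∈ Finset.Icc 1 p.1, z r n p.2 * (χ (n : ZMod k)).re) :=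
    measurable_from_prod_countable_right fun m =>
      Finset.measurable_sum (Finset.Icc 1 m) (f := fun n ω => z r n ω * (χ (n : ZMod k)).re)
        fun n _ => (measurable_z hr n).mul_const _
  rw [show C χ r N = _ from funext fun ω => C_eq_sum_re χ r N ω]
  exact h.comp ((measurable_pseudoPrime hr N).prodMk measurable_id)

end Measurability

section Law

variable [MeasurableSpace Ω] {μ : Measure Ω} {r : ℕ → Ω → ℝ}

theorem integral_z_add_three (hr : ∀ n, 3 ≤ n → Measurable (r n))
    (hunif : ∀ n, 3 ≤ n → pdf.IsUniform (r n) (Set.Icc (0 : ℝ) 1) μ volume) (j : ℕ) :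
    ∫ ω, z r (j + 3) ω ∂μ = 1 / Real.log ((j + 3 : ℕ) : ℝ) := by
  have h3 : 3 ≤ j + 3 := by omega
  have hlog := one_lt_log_add_three j
  have hz : z r (j + 3)
      = (r (j + 3) ⁻¹' Set.Iic (1 / Real.log ((j + 3 : ℕ) : ℝ))).indicator 1 := by
    funext ω
    classical
    rw [Set.indicator_apply]
    simp [z]
  have hle : 1 / Real.log ((j + 3 : ℕ) : ℝ) ≤ 1 := by
    rw [div_le_one (by linarith)]; exact hlog.le
  have hinter : Set.Icc (0 : ℝ) 1 ∩ Set.Iic (1 / Real.log ((j + 3 : ℕ) : ℝ))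
      = Set.Icc 0 (1 / Real.log ((j + 3 : ℕ) : ℝ)) := by
    ext x
    simp only [Set.mem_inter_iff, Set.mem_Icc, Set.mem_Iic]
    exact ⟨fun h => ⟨h.1.1, h.2⟩, fun h => ⟨⟨h.1, h.2.trans hle⟩, h.2⟩⟩
  rw [hz, integral_indicator_one (hr _ h3 measurableSet_Iic), measureReal_def,
    (hunif _ h3).measure_preimage (by simp) (by simp) measurableSet_Iic, hinter]
  simp only [Real.volume_Icc, sub_zero, ENNReal.ofReal_one, div_one]
  exact ENNReal.toReal_ofReal (one_div_nonneg.2 (by linarith))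

theorem iIndepFun_z_add_three
    (hindep : iIndepFun (fun (n : {n : ℕ // 3 ≤ n}) (ω : Ω) => r n ω) μ) :
    iIndepFun (fun j => z r (j + 3)) μ := by
  classical
  have h := hindep.precomp (g := fun j : ℕ => (⟨j + 3, by omega⟩ : {n : ℕ // 3 ≤ n}))
    fun i j hij => by simpa using hij
  have h2 := h.comp (fun j x => if x ≤ 1 / Real.log ((j + 3 : ℕ) : ℝ) then (1 : ℝ) else 0)
    fun j => Measurable.ite measurableSet_Iic measurable_const measurable_const
  convert! h2 using 2 with j
  funext ω
  simp [z]

end Law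

end CramerModel

theorem theorem1 {Ω : Type*} [MeasurableSpace Ω] (μ : Measure Ω) [IsProbabilityMeasure μ]
    (r : ℕ → Ω → ℝ)
    (hmeas : ∀ n, 3 ≤ n → Measurable (r n))
    (hunif : ∀ n, 3 ≤ n → pdf.IsUniform (r n) (Set.Icc (0 : ℝ) 1) μ volume)
    (hindep : iIndepFun (fun (n : {n : ℕ // 3 ≤ n}) (ω : Ω) => r n ω) μ)
    (k : ℕ) [NeZero k] (χ : DirichletCharacter ℂ k) (hχ : χ ≠ 1) :
    TendstoInDistribution
      (fun (N : ℕ) (ω : Ω) =>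
        Real.sqrt ((1 + Real.log (Real.log N) / Real.log N) / (CramerModel.sSq χ * N)) *
          CramerModel.C χ r N ω)
      atTop (id : ℝ → ℝ) (fun _ => μ) (gaussianReal 0 1) := by
  have hlog := one_lt_log_add_three
  have hq0 : ∀ j : ℕ, 0 ≤ 1 / Real.log ((j + 3 : ℕ) : ℝ) := fun j =>
    one_div_nonneg.2 (zero_le_one.trans (hlog j).le)
  have hq1 : ∀ j : ℕ, 1 / Real.log ((j + 3 : ℕ) : ℝ) ≤ 1 := fun j =>
    (div_le_one (zero_lt_one.trans (hlog j))).2 (hlog j).le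
  have hcast : ∀ j : ℕ, ((j + 3 : ℕ) : ZMod k) = (j : ZMod k) + 3 := fun j => by push_cast; rfl
  obtain ⟨B, hB⟩ := exists_abs_sum_mul_natCast_add_le (fun x => (χ x).re)
    (DirichletCharacter.sum_re_eq_zero hχ) 3 antitone_one_div_log_add_three
    tendsto_one_div_log_add_three
  have hvar := tendsto_sum_variance_div (fun x => (χ x).re) χ.sum_re_sq_sub_eq_zero 3
    antitone_one_div_log_add_three tendsto_one_div_log_add_three hq0
    tendsto_sum_one_div_log_add_three
  simp_rw [← hcast] at hB hvar
  refine tendstoInDistribution_mul_stopped_sum (Z := fun j => CramerModel.z r (j + 3))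
    (fun j => CramerModel.measurable_z hmeas _) (fun j => CramerModel.z_eq_zero_or_one r _)
    (CramerModel.iIndepFun_z_add_three hindep) (CramerModel.integral_z_add_three hmeas hunif)
    hq0 hq1 tendsto_sum_one_div_log_add_three (fun j => χ.abs_re_le_one _) hB χ.sSq_pos hvar
    (fun N => Real.sqrt_nonneg _) (tendsto_normalization χ.sSq_pos)
    (CramerModel.measurable_C hmeas χ) ?_
  -- At `N = 0` the truncated `N - 1` would select the first pseudo-prime.
  filter_upwards [eventually_ge_atTop 1] with N hN M ω hM
  exact CramerModel.C_eq_sum_fewerThan χ hN hM
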